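/- Let $n\ge 0$ and let $Cl_n$ be the $2^n$-dimensional real Clifford algebra generated by $\mathbb R^n$ with $x^2=-\|x\|^2$. Let $e_1,\dots,e_n$ be the standard orthonormal basis of $\mathbb R^n$; then $Cl_n$ has the basis $e_A=e_{i_1}\cdots e_{i_r}$, $A=\{i_1<\dots<i_r\}\subseteq\{1,\dots,n\}$, and every $f:\Omega\to Cl_n$ is written $f=\sum_A e_A f_A$ with real-valued sections $f_A$. Let $\Omega\subset\mathbb R^n$ be a bounded domain with $C^1$ boundary, i.e. a bounded, non-empty, connected open set such that near each boundary point, in suitable orthonormal coordinates, $\Omega$ is exactly the region lying strictly above the graph of a $C^1$ function. For $1<p<\infty$ and $k=0,1,2,\dots$ let $W^{p,k}(\Omega,\mathbb R)$ be the space of functions on $\Omega$ all of whose weak derivatives $D^jf$ with $|j|\le k$ exist and are $p$-integrable over $\Omega$, with $$\|f\|_{W^{p,k}(\Omega,\mathbb R)}=\Big(\sum_{|j|\le k}\|D^jf\|_{L^p(\Omega)}^p\Big)^{1/p},$$ and let $W^{p,k}(\Omega,Cl_n)$ be the space of all $f=\sum_A e_Af_A$ with every $f_A\in W^{p,k}(\Omega,\mathbb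 R)$, with $$\|f\|_{W^{p,k}(\Omega,Cl_n)}=\Big(\sum_A\|f_A\|_{W^{p,k}(\Omega,\mathbb R)}^p\Big)^{1/p}.$$ Then for every $f\in W^{p,k}(\Omega,Cl_n)$ and every $\varepsilon>0$ there is a function $\Psi=\sum_Ae_A\psi_A\in W^{p,k}(\Omega,Cl_n)$ which is $C^\infty$ up to the boundary, in the sense that each $\psi_A$ agrees on $\overline\Omega=\Omega\cup\partial\Omega$ with a $C^\infty$ function on $\mathbb R^n$, such that $$\|f-\Psi\|_{W^{p,k}(\Omega,Cl_n)}<\varepsilon .$$ -/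

import Mathlib

open MeasureTheory
open scoped ContDiff

/-! ## The Clifford algebra generated by `ℝⁿ` with `x² = -‖x‖²` -/

/-- The quadratic form `x ↦ -‖x‖²` on `ℝⁿ`. -/
noncomputable def cliffordForm (n : ℕ) : QuadraticForm ℝ (EuclideanSpace ℝ (Fin n)) :=
  -LinearMap.BilinMap.toQuadraticMap (innerₗ (EuclideanSpace ℝ (Fin n)))

theorem cliffordForm_apply (n : ℕ) (x : EuclideanSpace ℝ (Fin n)) :
    cliffordForm n x = -‖x‖ ^ 2 := by
  simp [cliffordForm]

/-- The real Clifford algebra `Cl_n`. -/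
abbrev Cl (n : ℕ) : Type := CliffordAlgebra (cliffordForm n)

/-- The generators `e_i` of `Cl_n`, images of the standard orthonormal basis of `ℝⁿ`. -/
noncomputable def cliffordGen {n : ℕ} (i : Fin n) : Cl n :=
  CliffordAlgebra.ι (cliffordForm n) (EuclideanSpace.single i (1 : ℝ))

theorem cliffordGen_mul_self {n : ℕ} (i : Fin n) :
    cliffordGen i * cliffordGen i = (-1 : Cl n) := by
  simp [cliffordGen, CliffordAlgebra.ι_sq_scalar, cliffordForm_apply]

theorem cliffordGen_mul_comm {n : ℕ} {i j : Fin n} (h : i ≠ j) :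
    cliffordGen i * cliffordGen j = (-(cliffordGen j * cliffordGen i) : Cl n) := by
  refine CliffordAlgebra.ι_mul_ι_comm_of_isOrtho ?_
  rw [QuadraticMap.isOrtho_def]
  simp only [cliffordForm_apply]
  have := norm_add_sq_real (EuclideanSpace.single i (1 : ℝ)) (EuclideanSpace.single j (1 : ℝ))
  have h0 : inner ℝ (EuclideanSpace.single i (1 : ℝ)) (EuclideanSpace.single j (1 : ℝ)) = 0 := by
    simp [EuclideanSpace.inner_single_left, h]
  rw [h0] at this
  linarith

/-- For `A = {i₁ < ⋯ < i_r}`, the product `e_A = e_{i₁} ⋯ e_{i_r}`; `e_∅ = 1`. -/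
noncomputable def cliffordMonomial {n : ℕ} (A : Finset (Fin n)) : Cl n :=
  ((A.sort (· ≤ ·)).map cliffordGen).prod

theorem cliffordMonomial_insert {n : ℕ} {a : Fin n} {A : Finset (Fin n)}
    (h : ∀ b ∈ A, a < b) :
    cliffordMonomial (insert a A) = cliffordGen a * cliffordMonomial A := by
  rw [cliffordMonomial, Finset.sort_insert (r := (· ≤ ·)) (fun b hb => (h b hb).le)
    (fun ha => lt_irrefl _ (h a ha))]
  simp [cliffordMonomial]

theorem cliffordGen_mul_monomial {n : ℕ} (A : Finset (Fin n)) (i : Fin n) :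
    ∃ (c : ℝ) (B : Finset (Fin n)), B ⊆ insert i A ∧
      cliffordGen i * cliffordMonomial A = c • cliffordMonomial B := by
  induction A using Finset.induction_on_min with
  | empty =>
    exact ⟨1, insert i ∅, subset_rfl, by rw [cliffordMonomial_insert (by simp), one_smul]⟩
  | insert a A h ih =>
    rw [cliffordMonomial_insert h]
    rcases lt_trichotomy i a with hi | rfl | hi
    · refine ⟨1, insert i (insert a A), subset_rfl, ?_⟩
      rw [cliffordMonomial_insert, cliffordMonomial_insert h, one_smul]
      intro b hb
      rcases Finset.mem_insert.1 hb with rfl | hb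
      · exact hi
      · exact hi.trans (h b hb)
    · refine ⟨-1, A, by intro x hx; simp [hx], ?_⟩
      rw [← mul_assoc, cliffordGen_mul_self]
      simp
    · obtain ⟨c, B, hB, hc⟩ := ih
      refine ⟨-c, insert a B, ?_, ?_⟩
      · intro x hx
        rcases Finset.mem_insert.1 hx with rfl | hx
        · simp
        · have := hB hx
          simp only [Finset.mem_insert] at this ⊢
          tauto
      · rw [cliffordMonomial_insert, ← mul_assoc, cliffordGen_mul_comm hi.ne', neg_mul,
          mul_assoc, hc]
        · simp
        · intro b hb
          rcases Finset.mem_insert.1 (hB hb) with rfl | hb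
          · exact hi
          · exact h b hb

theorem span_cliffordMonomial (n : ℕ) :
    Submodule.span ℝ (Set.range (cliffordMonomial (n := n))) = ⊤ := by
  set S := Submodule.span ℝ (Set.range (cliffordMonomial (n := n))) with hS
  have hgen : ∀ i : Fin n, ∀ y ∈ S, cliffordGen i * y ∈ S := by
    intro i y hy
    induction hy using Submodule.span_induction with
    | mem x hx =>
      obtain ⟨A, rfl⟩ := hx
      obtain ⟨c, B, -, h⟩ := cliffordGen_mul_monomial A i
      rw [h]
      exact S.smul_mem _ (Submodule.subset_span ⟨B, rfl⟩)
    | zero => simp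
    | add x y _ _ hx hy => rw [mul_add]; exact S.add_mem hx hy
    | smul c x _ hx => rw [mul_smul_comm]; exact S.smul_mem _ hx
  have hmul : ∀ x : Cl n, ∀ y ∈ S, x * y ∈ S := by
    intro x
    induction x using CliffordAlgebra.induction with
    | algebraMap r =>
      intro y hy
      rw [← Algebra.smul_def]; exact S.smul_mem _ hy
    | ι v =>
      intro y hy
      have hv : v = ∑ i, v i • EuclideanSpace.single i (1 : ℝ) := by
        ext j
        simp [Finset.sum_apply, Pi.single_apply]
      rw [hv, map_sum, Finset.sum_mul]
      refine S.sum_mem fun i _ => ?_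
      rw [map_smul, smul_mul_assoc]
      exact S.smul_mem _ (hgen i y hy)
    | mul a b ha hb => intro y hy; rw [mul_assoc]; exact ha _ (hb _ hy)
    | add a b ha hb => intro y hy; rw [add_mul]; exact S.add_mem (ha _ hy) (hb _ hy)
  have h1 : (1 : Cl n) ∈ S := Submodule.subset_span ⟨∅, by simp [cliffordMonomial]⟩
  exact eq_top_iff.2 fun x _ => by simpa using hmul x 1 h1

theorem finrank_clifford (n : ℕ) :
    Fintype.card (Finset (Fin n)) = Module.finrank ℝ (Cl n) := by
  rw [(CliffordAlgebra.equivExterior (cliffordForm n)).finrank_eq]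
  exact (Module.finrank_eq_card_basis
    (EuclideanSpace.basisFun (Fin n) ℝ).toBasis.ExteriorAlgebra).symm

/-- The basis `(e_A)_A` of the `2ⁿ`-dimensional algebra `Cl_n`, indexed by `A ⊆ {1, …, n}`. -/
noncomputable def cliffordBasis (n : ℕ) : Module.Basis (Finset (Fin n)) ℝ (Cl n) :=
  basisOfTopLeSpanOfCardEqFinrank cliffordMonomial (span_cliffordMonomial n).ge
    (finrank_clifford n)

theorem cliffordBasis_apply {n : ℕ} (A : Finset (Fin n)) :
    cliffordBasis n A = cliffordMonomial A := by
  simp [cliffordBasis]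

/-- The real section `f_A` of a `Cl_n`-valued function `f = ∑_A e_A f_A`. -/
noncomputable def cliffordSection {n : ℕ} {X : Type*} (f : X → Cl n) (A : Finset (Fin n)) :
    X → ℝ :=
  fun x => (cliffordBasis n).repr (f x) A

theorem sum_cliffordSection {n : ℕ} {X : Type*} (f : X → Cl n) (x : X) :
    ∑ A, cliffordSection f A x • cliffordMonomial A = f x := by
  simpa [cliffordSection, cliffordBasis_apply] using (cliffordBasis n).sum_repr (f x)

/-! ## Bounded domains with `C¹` boundary -/

/-- `Ω ⊆ ℝⁿ` has a `C¹` boundary: near each boundary point, in suitable orthonormal coordinates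
(`v` being the unit vector of the last one), `Ω` is exactly the region lying strictly above the
graph of a `C¹` function `γ` of the remaining coordinates, i.e. of a function on `v^⊥`. -/
def HasC1Boundary {n : ℕ} (Ω : Set (EuclideanSpace ℝ (Fin n))) : Prop :=
  ∀ x₀ ∈ frontier Ω, ∃ (r : ℝ) (v : EuclideanSpace ℝ (Fin n))
    (γ : (Submodule.span ℝ {v})ᗮ → ℝ), 0 < r ∧ ‖v‖ = 1 ∧ ContDiff ℝ 1 γ ∧
    ∀ x ∈ Metric.ball x₀ r,
      x ∈ Ω ↔ γ ((Submodule.span ℝ {v})ᗮ.orthogonalProjectionOnto x) < inner ℝ v x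

/-- A bounded domain (non-empty connected open set) of `ℝⁿ` with `C¹` boundary. -/
structure IsBoundedC1Domain {n : ℕ} (Ω : Set (EuclideanSpace ℝ (Fin n))) : Prop where
  isOpen : IsOpen Ω
  isConnected : IsConnected Ω
  isBounded : Bornology.IsBounded Ω
  hasC1Boundary : HasC1Boundary Ω

/-- `ψ` is `C^∞` up to the boundary of `Ω`: on the closure of `Ω` it agrees with a `C^∞` function
defined on all of `ℝⁿ`. -/
def SmoothUpToBoundary {n : ℕ} (Ω : Set (EuclideanSpace ℝ (Fin n)))
    (ψ : EuclideanSpace ℝ (Fin n) → ℝ) : Prop :=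
  ∃ ψ' : EuclideanSpace ℝ (Fin n) → ℝ, ContDiff ℝ ∞ ψ' ∧ Set.EqOn ψ ψ' (closure Ω)

/-! ## Weak derivatives and Sobolev spaces

Functions on `Ω` are represented by functions on `ℝⁿ`; only their values on `Ω` matter. -/

/-- The partial derivative `∂φ/∂x_i`. -/
noncomputable def partialD {n : ℕ} (i : Fin n) (φ : EuclideanSpace ℝ (Fin n) → ℝ) :
    EuclideanSpace ℝ (Fin n) → ℝ :=
  fun x => fderiv ℝ φ x (EuclideanSpace.single i 1)

/-- `D^j φ = ∂₁^{j₁} ⋯ ∂ₙ^{jₙ} φ` for a multi-index `j`. -/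
noncomputable def multiD {n : ℕ} (j : Fin n → ℕ) (φ : EuclideanSpace ℝ (Fin n) → ℝ) :
    EuclideanSpace ℝ (Fin n) → ℝ :=
  (List.finRange n).foldr (fun i g => (partialD i)^[j i] g) φ

/-- The multi-indices `j` with `|j| ≤ k`. -/
def multiIndices (n k : ℕ) : Finset (Fin n → ℕ) :=
  {j ∈ Fintype.piFinset fun _ => Finset.range (k + 1) | ∑ i, j i ≤ k}

theorem mem_multiIndices {n k : ℕ} {j : Fin n → ℕ} : j ∈ multiIndices n k ↔ ∑ i, j i ≤ k := by
  simp only [multiIndices, Finset.mem_filter, Fintype.mem_piFinset, Finset.mem_range,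
    and_iff_right_iff_imp]
  exact fun h i => Nat.lt_succ_of_le
    ((Finset.single_le_sum (fun _ _ => Nat.zero_le _) (Finset.mem_univ i)).trans h)

/-- `g` is a `j`-th weak derivative of `f` on `Ω`. -/
def HasWeakDeriv {n : ℕ} (Ω : Set (EuclideanSpace ℝ (Fin n))) (j : Fin n → ℕ)
    (f g : EuclideanSpace ℝ (Fin n) → ℝ) : Prop :=
  LocallyIntegrableOn f Ω ∧ LocallyIntegrableOn g Ω ∧
    ∀ φ : EuclideanSpace ℝ (Fin n) → ℝ, ContDiff ℝ ∞ φ → HasCompactSupport φ → tsupport φ ⊆ Ω →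
      ∫ x in Ω, g x * φ x = (-1) ^ (∑ i, j i) * ∫ x in Ω, f x * multiD j φ x

open Classical in
/-- The `j`-th weak derivative `D^j f` on `Ω` (unique up to null sets), `0` if there is none. -/
noncomputable def weakD {n : ℕ} (Ω : Set (EuclideanSpace ℝ (Fin n))) (j : Fin n → ℕ)
    (f : EuclideanSpace ℝ (Fin n) → ℝ) : EuclideanSpace ℝ (Fin n) → ℝ :=
  if h : ∃ g, HasWeakDeriv Ω j f g then h.choose else 0

/-- `f ∈ W^{p,k}(Ω, ℝ)`: all weak derivatives of order at most `k` exist and are `p`-integrable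
over `Ω` (for `j = 0` this says that `f` itself is). -/
def MemSobolev {n : ℕ} (p : ℝ) (k : ℕ) (Ω : Set (EuclideanSpace ℝ (Fin n)))
    (f : EuclideanSpace ℝ (Fin n) → ℝ) : Prop :=
  ∀ j : Fin n → ℕ, ∑ i, j i ≤ k →
    ∃ g, HasWeakDeriv Ω j f g ∧ MemLp g (ENNReal.ofReal p) (volume.restrict Ω)

/-- The norm `(∑_{|j| ≤ k} ‖D^j f‖_{L^p(Ω)}^p)^{1/p}`, for `f ∈ W^{p,k}(Ω, ℝ)`. -/
noncomputable def sobolevNorm {n : ℕ} (p : ℝ) (k : ℕ) (Ω : Set (EuclideanSpace ℝ (Fin n)))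
    (f : EuclideanSpace ℝ (Fin n) → ℝ) : ENNReal :=
  (∑ j ∈ multiIndices n k,
    eLpNorm (weakD Ω j f) (ENNReal.ofReal p) (volume.restrict Ω) ^ p) ^ p⁻¹

/-- `f ∈ W^{p,k}(Ω, Cl_n)`: every section `f_A` is in `W^{p,k}(Ω, ℝ)`. -/
def MemCliffordSobolev {n : ℕ} (p : ℝ) (k : ℕ) (Ω : Set (EuclideanSpace ℝ (Fin n)))
    (f : EuclideanSpace ℝ (Fin n) → Cl n) : Prop :=
  ∀ A, MemSobolev p k Ω (cliffordSection f A)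

/-- The norm `(∑_A ‖f_A‖_{W^{p,k}(Ω, ℝ)}^p)^{1/p}`, for `f ∈ W^{p,k}(Ω, Cl_n)`. -/
noncomputable def cliffordSobolevNorm {n : ℕ} (p : ℝ) (k : ℕ)
    (Ω : Set (EuclideanSpace ℝ (Fin n))) (f : EuclideanSpace ℝ (Fin n) → Cl n) : ENNReal :=
  (∑ A, sobolevNorm p k Ω (cliffordSection f A) ^ p) ^ p⁻¹

/-! Ordinary mollification of the extension by zero fails near the boundary, where the jump of the
extension spoils the derivatives. The remedy is a mollifier supported off centre. A `C¹` graph is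
locally Lipschitz, so near each boundary point one truncated cone, translated to any nearby point of
Ω, stays inside Ω (`HasC1Boundary.exists_hasInteriorCone`). If the mollifier is supported in a small
ball around `-(t • v)`, with `v` the cone axis, the convolution at `x ∈ Ω` samples only points of Ω
in the cone at `x`. The reflected mollifier is then an admissible test function, so on Ω the
classical derivatives of the mollified function are the mollified weak derivatives. They converge in
`L^p` because translations are continuous there.

This treats a function cut off near one point (`HasInteriorCone.smoothlyApproximable_mul`).
Compactness of the closure and cutoffs along a finite cover handle a real Sobolev function; the
Clifford statement follows section by section. -/

/-! ### Classical multi-index derivatives. -/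

section MultiD

variable {n : ℕ} {φ ψ : EuclideanSpace ℝ (Fin n) → ℝ}

theorem ContDiff.partialD (hφ : ContDiff ℝ ∞ φ) (i : Fin n) : ContDiff ℝ ∞ (partialD i φ) :=
  (hφ.fderiv_right (m := ∞) (by simp)).clm_apply contDiff_const

theorem partialD_comm (hφ : ContDiff ℝ ∞ φ) (i j : Fin n) :
    partialD i (partialD j φ) = partialD j (partialD i φ) := by
  funext x
  have hd : DifferentiableAt ℝ (fderiv ℝ φ) x :=
    (hφ.fderiv_right (m := ∞) (by simp)).differentiable (by simp) x
  have hs : IsSymmSndFDerivAt ℝ φ x := hφ.contDiffAt.isSymmSndFDerivAt 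
    (by
      rw [minSmoothness_of_isRCLikeNormedField]
      exact WithTop.coe_le_coe.2 (le_top : (2 : ℕ∞) ≤ ⊤))
  have key : ∀ a b : Fin n, partialD a (partialD b φ) x =
      fderiv ℝ (fderiv ℝ φ) x (EuclideanSpace.single a 1) (EuclideanSpace.single b 1) := by
    intro a b
    have h : HasFDerivAt (partialD b φ) _ x :=
      hd.hasFDerivAt.clm_apply (hasFDerivAt_const (EuclideanSpace.single b (1 : ℝ)) x)
    rw [partialD, h.fderiv]
    simp
  rw [key, key, hs.eq]

theorem ContDiff.iterate_partialD (hφ : ContDiff ℝ ∞ φ) (i : Fin n) (m : ℕ) :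
    ContDiff ℝ ∞ ((_root_.partialD i)^[m] φ) := by
  induction m with
  | zero => exact hφ
  | succ m ih => rw [Function.iterate_succ_apply']; exact ih.partialD i

theorem iterate_partialD_comm (hφ : ContDiff ℝ ∞ φ) (i j : Fin n) (m : ℕ) :
    (partialD i)^[m] (partialD j φ) = partialD j ((partialD i)^[m] φ) := by
  induction m with
  | zero => rfl
  | succ m ih =>
    rw [Function.iterate_succ_apply', Function.iterate_succ_apply', ih,
      partialD_comm (hφ.iterate_partialD i m)]

theorem contDiff_foldr_partialD (hφ : ContDiff ℝ ∞ φ) (j : Fin n → ℕ) (l : List (Fin n)) :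
    ContDiff ℝ ∞ (l.foldr (fun i g => (partialD i)^[j i] g) φ) := by
  induction l with
  | nil => exact hφ
  | cons a l ih => exact ih.iterate_partialD a _

theorem ContDiff.multiD (hφ : ContDiff ℝ ∞ φ) (j : Fin n → ℕ) : ContDiff ℝ ∞ (multiD j φ) :=
  contDiff_foldr_partialD hφ j _

/-- `multiD` differentiates in a fixed order; symmetry of second derivatives lets the extra `∂_i`
move outermost. With `multiIndex_induction` this reduces every later statement about `D^j` to one
derivative at a time. -/
theorem multiD_add_single (hφ : ContDiff ℝ ∞ φ) (j : Fin n → ℕ) (i : Fin n) :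
    multiD (j + Pi.single i 1) φ = partialD i (multiD j φ) := by
  have notMem : ∀ l : List (Fin n), i ∉ l →
      l.foldr (fun a g => (partialD a)^[(j + Pi.single i 1 : Fin n → ℕ) a] g) φ =
        l.foldr (fun a g => (partialD a)^[j a] g) φ := by
    intro l hl
    refine List.foldr_ext _ _ _ fun a ha g => ?_
    have : a ≠ i := fun h => hl (h ▸ ha)
    simp [this]
  have mem : ∀ l : List (Fin n), l.Nodup → i ∈ l →
      l.foldr (fun a g => (partialD a)^[(j + Pi.single i 1 : Fin n → ℕ) a] g) φ =
        partialD i (l.foldr (fun a g => (partialD a)^[j a] g) φ) := by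
    intro l hl hi
    induction l with
    | nil => simp at hi
    | cons a l ih =>
      simp only [List.foldr_cons]
      rcases eq_or_ne a i with rfl | ha
      · rw [notMem l (List.nodup_cons.1 hl).1]
        simp [Function.iterate_succ_apply']
      · rw [ih (List.nodup_cons.1 hl).2 ((List.mem_cons.1 hi).resolve_left ha.symm),
          iterate_partialD_comm (contDiff_foldr_partialD hφ j l)]
        simp [ha]
  exact mem _ (List.nodup_finRange n) (List.mem_finRange i)

theorem multiD_zero : multiD 0 φ = φ := by
  have : ∀ l : List (Fin n),
      l.foldr (fun a g => (partialD a)^[(0 : Fin n → ℕ) a] g) φ = φ := by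
    intro l
    induction l with
    | nil => rfl
    | cons a l ih => simp
  exact this _

theorem multiD_single (hφ : ContDiff ℝ ∞ φ) (i : Fin n) :
    multiD (Pi.single i 1) φ = partialD i φ := by
  have := multiD_add_single hφ 0 i
  rwa [zero_add, multiD_zero] at this

theorem multiIndex_induction {P : (Fin n → ℕ) → Prop} (zero : P 0)
    (add_single : ∀ j i, P j → P (j + Pi.single i 1)) (j : Fin n → ℕ) : P j := by
  induction h : ∑ i, j i generalizing j with
  | zero =>
    have : j = 0 := by
      funext i
      simpa using (Finset.sum_eq_zero_iff.1 h) i (Finset.mem_univ i)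
    exact this ▸ zero
  | succ m ih =>
    obtain ⟨i, -, hi⟩ := Finset.exists_ne_zero_of_sum_ne_zero (h.trans_ne m.succ_ne_zero)
    have hj : j = (j - Pi.single i 1) + Pi.single i 1 := by
      funext a
      rcases eq_or_ne a i with rfl | ha
      · simp; omega
      · simp [ha]
    rw [hj]
    refine add_single _ _ (ih _ ?_)
    have h' := h
    rw [hj] at h'
    simpa [Finset.sum_add_distrib] using h'

theorem tsupport_partialD_subset (i : Fin n) : tsupport (partialD i φ) ⊆ tsupport φ := by
  refine (closure_mono fun x hx => ?_).trans (tsupport_fderiv_subset ℝ (f := φ))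
  rw [Function.mem_support] at hx ⊢
  intro h
  exact hx (by simp [partialD, h])

theorem tsupport_multiD_subset (hφ : ContDiff ℝ ∞ φ) (j : Fin n → ℕ) :
    tsupport (multiD j φ) ⊆ tsupport φ := by
  induction j using multiIndex_induction with
  | zero => rw [multiD_zero]
  | add_single j i ih =>
    rw [multiD_add_single hφ]
    exact (tsupport_partialD_subset i).trans ih

theorem HasCompactSupport.multiD (h : HasCompactSupport φ) (hφ : ContDiff ℝ ∞ φ)
    (j : Fin n → ℕ) : HasCompactSupport (multiD j φ) :=
  h.of_isClosed_subset (isClosed_tsupport _) (tsupport_multiD_subset hφ j)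

theorem partialD_mul (hφ : ContDiff ℝ ∞ φ) (hψ : ContDiff ℝ ∞ ψ) (i : Fin n)
    (x : EuclideanSpace ℝ (Fin n)) :
    partialD i (fun y => φ y * ψ y) x = φ x * partialD i ψ x + partialD i φ x * ψ x := by
  simp only [partialD]
  rw [fderiv_fun_mul (hφ.differentiable (by simp) x) (hψ.differentiable (by simp) x)]
  simp [mul_comm]

theorem multiD_comp_sub_left (hφ : ContDiff ℝ ∞ φ) (j : Fin n → ℕ)
    (a : EuclideanSpace ℝ (Fin n)) :
    multiD j (fun x => φ (a - x)) = fun x => (-1) ^ (∑ i, j i) * multiD j φ (a - x) := by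
  have hs : ContDiff ℝ ∞ fun x => φ (a - x) := hφ.comp (contDiff_const.sub contDiff_id)
  induction j using multiIndex_induction with
  | zero => simp [multiD_zero]
  | add_single j i ih =>
    rw [multiD_add_single hs, multiD_add_single hφ, ih]
    funext x
    have hd : DifferentiableAt ℝ (multiD j φ) (a - x) :=
      (hφ.multiD j).differentiable (by simp) _
    have h2 : HasFDerivAt (fun x => (-1) ^ (∑ i, j i) * multiD j φ (a - x)) _ x :=
      ((hd.hasFDerivAt.comp x ((hasFDerivAt_id x).const_sub a)).const_mul _)
    simp only [partialD]
    rw [h2.fderiv]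
    simp [Finset.sum_add_distrib, pow_succ]

/-- All derivatives fall on the smooth factor, so `u` need only be locally integrable. -/
theorem multiD_convolution {u : EuclideanSpace ℝ (Fin n) → ℝ} (hu : LocallyIntegrable u)
    (hφ : ContDiff ℝ ∞ φ) (hc : HasCompactSupport φ) (j : Fin n → ℕ) :
    multiD j (convolution u φ (ContinuousLinearMap.mul ℝ ℝ) volume) =
      convolution u (multiD j φ) (ContinuousLinearMap.mul ℝ ℝ) volume := by
  have hs : ContDiff ℝ ∞ (convolution u φ (ContinuousLinearMap.mul ℝ ℝ) volume) :=
    hc.contDiff_convolution_right _ hu hφ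
  induction j using multiIndex_induction with
  | zero => simp [multiD_zero]
  | add_single j i ih =>
    rw [multiD_add_single hs, multiD_add_single hφ, ih]
    funext x
    have h := (hc.multiD hφ j).hasFDerivAt_convolution_right (ContinuousLinearMap.mul ℝ ℝ)
      hu ((hφ.multiD j).of_le (by simp)) x
    simp only [partialD]
    rw [h.fderiv, convolution_precompR_apply _ hu ((hc.multiD hφ j).fderiv ℝ)
      (((hφ.multiD j).fderiv_right (m := ∞) (by simp)).continuous)]
    rfl

end MultiD

/-! ### Convergence of mollification in `L^p`. -/

section Mollification

variable {E : Type*} [NormedAddCommGroup E] [NormedSpace ℝ E] [FiniteDimensional ℝ E]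
  [MeasurableSpace E] [BorelSpace E] {μ : Measure E} [μ.IsAddHaarMeasure]

/-- Continuity of the translation action on `L^p`, `p < ∞`, evaluated at the identity. -/
theorem eventually_eLpNorm_comp_sub_sub_le {p : ENNReal} (hp : 1 ≤ p) (hp' : p ≠ ⊤) {g : E → ℝ}
    (hg : MemLp g p μ) {ε : ENNReal} (hε : ε ≠ 0) :
    ∀ᶠ y in nhds (0 : E), eLpNorm (fun x => g (x - y) - g x) p μ ≤ ε := by
  have : Fact (1 ≤ p) := ⟨hp⟩
  have : Fact (p ≠ ⊤) := ⟨hp'⟩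
  have hc : Continuous fun y : E => DomAddAct.mk (-y) +ᵥ hg.toLp :=
    (DomAddAct.mkHomeomorph.continuous.comp continuous_neg).vadd continuous_const
  have ht := hc.tendsto 0
  rw [EMetric.tendsto_nhds] at ht
  filter_upwards [ht ε (pos_iff_ne_zero.2 hε)] with y hy
  simp only [DomAddAct.mk_vadd_toLp, neg_zero, zero_vadd] at hy
  rw [Lp.edist_toLp_toLp] at hy
  have heq : (fun x => g (x - y) - g x) = (fun x => g (-y +ᵥ x)) - fun x => g x := by
    funext x
    simp [sub_eq_neg_add]
  exact heq ▸ hy.le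

/-- With `ρ` as a probability density, `g * ρ - g` is an average of the differences `g (· - y) - g`;
Jensen and Tonelli bound its norm by theirs. Only shifts with `ρ y ≠ 0` matter, so `ρ` need not be
centred at `0`. -/
theorem eLpNorm_convolution_sub_le {p : ENNReal} (hp : 1 ≤ p) (hp' : p ≠ ⊤) {g ρ : E → ℝ}
    (hg : MemLp g p μ) (hρ : Continuous ρ) (hρc : HasCompactSupport ρ) (hρ0 : ∀ y, 0 ≤ ρ y)
    (hρ1 : ∫ y, ρ y ∂μ = 1) {ε : ENNReal}
    (h : ∀ y, ρ y ≠ 0 → eLpNorm (fun x => g (x - y) - g x) p μ ≤ ε) :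
    eLpNorm (fun x => g x - convolution g ρ (ContinuousLinearMap.mul ℝ ℝ) μ x) p μ ≤ ε := by
  have hp0 : p ≠ 0 := (zero_lt_one.trans_le hp).ne'
  have hq : 0 < p.toReal := ENNReal.toReal_pos hp0 hp'
  have hρi : Integrable ρ μ := hρ.integrable_of_hasCompactSupport hρc
  set ν : Measure E := μ.withDensity fun y => ENNReal.ofReal (ρ y) with hν
  have hρm : Measurable fun y => ENNReal.ofReal (ρ y) := hρ.measurable.ennreal_ofReal
  have : IsProbabilityMeasure ν := by
    refine ⟨?_⟩
    rw [hν, withDensity_apply _ MeasurableSet.univ, Measure.restrict_univ,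
      ← ofReal_integral_eq_lintegral_ofReal hρi (.of_forall hρ0), hρ1, ENNReal.ofReal_one]
  have hac : ν ≪ μ := withDensity_absolutelyContinuous _ _
  have hconv : ∀ x, convolution g ρ (ContinuousLinearMap.mul ℝ ℝ) μ x - g x =
      ∫ y, (g (x - y) - g x) ∂ν := by
    intro x
    have h1 : Integrable (fun y => g (x - y) * ρ y) μ := by
      have := (hρc.convolutionExists_right (ContinuousLinearMap.mul ℝ ℝ)
        (hg.locallyIntegrable hp) hρ x).integrable_swap
      simpa using this
    rw [convolution_eq_swap, hν, integral_withDensity_eq_integral_toReal_smul hρm (by simp)]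
    have h2 : ∀ y, (ENNReal.ofReal (ρ y)).toReal • (g (x - y) - g x) =
        g (x - y) * ρ y - g x * ρ y := by
      intro y
      rw [ENNReal.toReal_ofReal (hρ0 y), smul_eq_mul]; ring
    simp_rw [h2]
    rw [integral_sub h1 (hρi.const_mul _), integral_const_mul, hρ1]
    simp
  have hgm := hg.aestronglyMeasurable
  have hm : AEStronglyMeasurable (fun z : E × E => g (z.1 - z.2) - g z.1) (μ.prod ν) := by
    refine AEStronglyMeasurable.mono_ac (Measure.AbsolutelyContinuous.rfl.prod hac) ?_
    exact (hgm.comp_quasiMeasurePreserving (quasiMeasurePreserving_sub μ μ)).sub hgm.comp_fst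
  have hslice : ∀ x, AEStronglyMeasurable (fun y => g (x - y) - g x) ν := by
    intro x
    refine AEStronglyMeasurable.mono_ac hac ?_
    exact (hgm.comp_measurePreserving (Measure.measurePreserving_sub_left μ x)).sub
      aestronglyMeasurable_const
  have hJ : ∀ x, ‖g x - convolution g ρ (ContinuousLinearMap.mul ℝ ℝ) μ x‖ₑ ^ p.toReal ≤
      ∫⁻ y, ‖g (x - y) - g x‖ₑ ^ p.toReal ∂ν := by
    intro x
    rw [← enorm_neg, neg_sub, hconv x]
    calc _ ≤ (eLpNorm (fun y => g (x - y) - g x) p ν) ^ p.toReal := by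
          gcongr
          refine (enorm_integral_le_lintegral_enorm _).trans ?_
          rw [← eLpNorm_one_eq_lintegral_enorm]
          -- Jensen, in the form that `L^1` norms are at most `L^p` norms on a probability space.
          exact eLpNorm_le_eLpNorm_of_exponent_le hp (hslice x)
      _ = _ := by
          rw [eLpNorm_eq_lintegral_rpow_enorm_toReal hp0 hp', ← ENNReal.rpow_mul,
            one_div_mul_cancel hq.ne', ENNReal.rpow_one]
  rw [eLpNorm_eq_lintegral_rpow_enorm_toReal hp0 hp']
  rw [one_div, ENNReal.rpow_inv_le_iff hq]
  calc _ ≤ ∫⁻ x, ∫⁻ y, ‖g (x - y) - g x‖ₑ ^ p.toReal ∂ν ∂μ := lintegral_mono hJ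
    _ = ∫⁻ y, ∫⁻ x, ‖g (x - y) - g x‖ₑ ^ p.toReal ∂μ ∂ν :=
        lintegral_lintegral_swap (hm.enorm.pow_const _)
    _ ≤ ∫⁻ _, ε ^ p.toReal ∂ν := by
        refine lintegral_mono_ae ?_
        rw [hν, ae_withDensity_iff hρm]
        refine .of_forall fun y hy => ?_
        have := h y fun h0 => hy (by simp [h0])
        rwa [eLpNorm_eq_lintegral_rpow_enorm_toReal hp0 hp', one_div,
          ENNReal.rpow_inv_le_iff hq] at this
    _ = ε ^ p.toReal := by simp

end Mollification

/-! ### Weak derivatives: uniqueness, composition, product rule. -/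

section WeakDerivatives

variable {n : ℕ} {Ω : Set (EuclideanSpace ℝ (Fin n))} {j : Fin n → ℕ} {i : Fin n}
  {f f' g g' h φ η : EuclideanSpace ℝ (Fin n) → ℝ}

theorem multiD_partialD (hφ : ContDiff ℝ ∞ φ) (j : Fin n → ℕ) (i : Fin n) :
    multiD j (partialD i φ) = partialD i (multiD j φ) := by
  induction j using multiIndex_induction with
  | zero => simp only [multiD_zero]
  | add_single j a ih =>
    rw [multiD_add_single (hφ.partialD i), ih, multiD_add_single hφ,
      partialD_comm (hφ.multiD j)]

theorem MeasureTheory.LocallyIntegrableOn.integrableOn_mul (hf : LocallyIntegrableOn f Ω)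
    (hφ : Continuous φ) (hc : HasCompactSupport φ) (hs : tsupport φ ⊆ Ω) :
    IntegrableOn (fun x => f x * φ x) Ω := by
  have h : IntegrableOn (fun x => f x * φ x) (tsupport φ) := by
    obtain ⟨C, hC⟩ := hφ.bounded_above_of_compact_support hc
    simpa only [IntegrableOn, mul_comm] using Integrable.bdd_mul
      (hf.integrableOn_compact_subset hs hc) hφ.aestronglyMeasurable (.of_forall hC)
  rw [integrableOn_iff_integrable_of_support_subset] at h
  · exact h.integrableOn
  · exact (Function.support_mul_subset_right f φ).trans (subset_tsupport φ)

theorem MeasureTheory.LocallyIntegrableOn.congr_set (hf : LocallyIntegrableOn f Ω)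
    (hΩ : IsOpen Ω) (h : Set.EqOn f f' Ω) : LocallyIntegrableOn f' Ω := by
  rw [locallyIntegrableOn_iff hΩ.isLocallyClosed] at hf ⊢
  exact fun K hK hc => (hf K hK hc).congr_fun (fun x hx => h (hK hx)) hc.measurableSet

theorem HasWeakDeriv.congr_left (hfg : HasWeakDeriv Ω j f g) (hΩ : IsOpen Ω)
    (h : Set.EqOn f f' Ω) : HasWeakDeriv Ω j f' g := by
  refine ⟨LocallyIntegrableOn.congr_set hfg.1 hΩ h, hfg.2.1, fun φ hφ hc hs => ?_⟩
  rw [hfg.2.2 φ hφ hc hs]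
  congr 1
  exact setIntegral_congr_fun hΩ.measurableSet fun x hx => by simp only [h hx]

theorem hasWeakDeriv_zero (hf : LocallyIntegrableOn f Ω) : HasWeakDeriv Ω 0 f f :=
  ⟨hf, hf, fun φ _ _ _ => by simp [multiD_zero]⟩

theorem sum_add_single (j : Fin n → ℕ) (i : Fin n) :
    ∑ a, (j + Pi.single i 1 : Fin n → ℕ) a = ∑ a, j a + 1 := by
  simp [Finset.sum_add_distrib]

theorem HasWeakDeriv.integral_multiD (hfg : HasWeakDeriv Ω (Pi.single i 1) f g)
    (hφ : ContDiff ℝ ∞ φ) (hc : HasCompactSupport φ) (hs : tsupport φ ⊆ Ω) (j : Fin n → ℕ) :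
    ∫ x in Ω, g x * multiD j φ x = -∫ x in Ω, f x * multiD (j + Pi.single i 1) φ x := by
  rw [hfg.2.2 _ (hφ.multiD j) (hc.multiD hφ j) ((tsupport_multiD_subset hφ j).trans hs),
    multiD_single (hφ.multiD j), multiD_add_single hφ]
  simp

theorem HasWeakDeriv.trans (hfg : HasWeakDeriv Ω (Pi.single i 1) f g)
    (hgh : HasWeakDeriv Ω j g h) : HasWeakDeriv Ω (j + Pi.single i 1) f h := by
  refine ⟨hfg.1, hgh.2.1, fun φ hφ hc hs => ?_⟩
  rw [hgh.2.2 φ hφ hc hs, hfg.integral_multiD hφ hc hs, sum_add_single, pow_succ]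
  ring

/-- Testing `g` against `D^j φ` moves one more derivative onto the test function. This is why the
first weak derivatives of a `W^{p,k+1}` function lie in `W^{p,k}`. -/
theorem HasWeakDeriv.of_add_single (hfg : HasWeakDeriv Ω (Pi.single i 1) f g)
    (hfh : HasWeakDeriv Ω (j + Pi.single i 1) f h) : HasWeakDeriv Ω j g h := by
  refine ⟨hfg.2.1, hfh.2.1, fun φ hφ hc hs => ?_⟩
  rw [hfh.2.2 φ hφ hc hs, hfg.integral_multiD hφ hc hs, sum_add_single, pow_succ]
  ring

/-- The fundamental lemma of the calculus of variations; it makes the choice in `weakD` harmless. -/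
theorem HasWeakDeriv.ae_eq (hΩ : IsOpen Ω) (hg : HasWeakDeriv Ω j f g)
    (hg' : HasWeakDeriv Ω j f g') : g =ᵐ[volume.restrict Ω] g' := by
  have h0 : ∀ᵐ x, x ∈ Ω → g x - g' x = 0 := by
    refine hΩ.ae_eq_zero_of_integral_contDiff_smul_eq_zero (hg.2.1.sub hg'.2.1)
      fun φ hφ hc hs => ?_
    rw [← setIntegral_eq_integral_of_forall_compl_eq_zero (s := Ω)
      fun x hx => by simp [image_eq_zero_of_notMem_tsupport fun h => hx (hs h)]]
    have h1 : ∀ x, φ x • (g x - g' x) = g x * φ x - g' x * φ x := fun x => by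
      rw [smul_eq_mul]; ring
    simp_rw [h1]
    rw [integral_sub (hg.2.1.integrableOn_mul hφ.continuous hc hs)
      (hg'.2.1.integrableOn_mul hφ.continuous hc hs), hg.2.2 φ hφ hc hs,
      hg'.2.2 φ hφ hc hs, sub_self]
  rw [Filter.EventuallyEq, ae_restrict_iff' hΩ.measurableSet]
  filter_upwards [h0] with x hx hxΩ using sub_eq_zero.1 (hx hxΩ)

theorem HasWeakDeriv.add (hg : HasWeakDeriv Ω j f g) (hg' : HasWeakDeriv Ω j f' g') :
    HasWeakDeriv Ω j (f + f') (g + g') := by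
  refine ⟨hg.1.add hg'.1, hg.2.1.add hg'.2.1, fun φ hφ hc hs => ?_⟩
  have hφ' := (hφ.multiD j).continuous
  have hc' := hc.multiD hφ j
  simp only [Pi.add_apply, add_mul]
  have hs' := (tsupport_multiD_subset hφ j).trans hs
  rw [integral_add (hg.2.1.integrableOn_mul hφ.continuous hc hs)
      (hg'.2.1.integrableOn_mul hφ.continuous hc hs),
    integral_add (hg.1.integrableOn_mul hφ' hc' hs') (hg'.1.integrableOn_mul hφ' hc' hs'),
    hg.2.2 φ hφ hc hs, hg'.2.2 φ hφ hc hs, mul_add]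

theorem HasWeakDeriv.neg (hg : HasWeakDeriv Ω j f g) : HasWeakDeriv Ω j (-f) (-g) := by
  refine ⟨hg.1.neg, hg.2.1.neg, fun φ hφ hc hs => ?_⟩
  simp only [Pi.neg_apply, neg_mul, integral_neg, hg.2.2 φ hφ hc hs, mul_neg]

theorem HasWeakDeriv.sub (hg : HasWeakDeriv Ω j f g) (hg' : HasWeakDeriv Ω j f' g') :
    HasWeakDeriv Ω j (f - f') (g - g') := by
  simpa only [sub_eq_add_neg] using hg.add hg'.neg

theorem integral_partialD_mul (hf : ContDiff ℝ ∞ f) (hφ : ContDiff ℝ ∞ φ)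
    (hc : HasCompactSupport φ) (i : Fin n) :
    ∫ x, partialD i f x * φ x = -∫ x, f x * partialD i φ x := by
  have hφ' := (hφ.partialD i)
  have hc' : HasCompactSupport (partialD i φ) :=
    hc.of_isClosed_subset (isClosed_tsupport _) (tsupport_partialD_subset i)
  rw [eq_neg_iff_add_eq_zero, ← neg_eq_iff_add_eq_zero]
  refine (integral_mul_fderiv_eq_neg_fderiv_mul_of_integrable (f := f) (g := φ)
    (v := EuclideanSpace.single i 1) ?_ ?_ ?_ (fun x _ => hf.differentiable (by simp) x)
    fun x _ => hφ.differentiable (by simp) x).symm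
  · exact ((hf.partialD i).continuous.mul hφ.continuous).integrable_of_hasCompactSupport
      hc.mul_left
  · exact (hf.continuous.mul hφ'.continuous).integrable_of_hasCompactSupport hc'.mul_left
  · exact (hf.continuous.mul hφ.continuous).integrable_of_hasCompactSupport hc.mul_left

theorem integral_multiD_mul (hf : ContDiff ℝ ∞ f) (hφ : ContDiff ℝ ∞ φ)
    (hc : HasCompactSupport φ) (j : Fin n → ℕ) :
    ∫ x, multiD j f x * φ x = (-1) ^ (∑ a, j a) * ∫ x, f x * multiD j φ x := by
  induction j using multiIndex_induction generalizing φ with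
  | zero => simp [multiD_zero]
  | add_single j i ih =>
    rw [multiD_add_single hf, integral_partialD_mul (hf.multiD j) hφ hc,
      ih (hφ.partialD i) (hc.of_isClosed_subset (isClosed_tsupport _)
        (tsupport_partialD_subset i)), multiD_partialD hφ, ← multiD_add_single hφ,
      sum_add_single, pow_succ]
    ring

theorem ContDiff.hasWeakDeriv (hf : ContDiff ℝ ∞ f) (Ω : Set (EuclideanSpace ℝ (Fin n)))
    (j : Fin n → ℕ) : HasWeakDeriv Ω j f (_root_.multiD j f) := by
  refine ⟨hf.continuous.locallyIntegrable.locallyIntegrableOn _,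
    (hf.multiD j).continuous.locallyIntegrable.locallyIntegrableOn _, fun φ hφ hc hs => ?_⟩
  rw [setIntegral_eq_integral_of_forall_compl_eq_zero
      fun x hx => by simp [image_eq_zero_of_notMem_tsupport fun h => hx (hs h)],
    setIntegral_eq_integral_of_forall_compl_eq_zero
      fun x hx => by
        simp [image_eq_zero_of_notMem_tsupport fun h => hx (hs (tsupport_multiD_subset hφ j h))],
    integral_multiD_mul hf hφ hc]

/-- Test the weak derivative of `f` against `η φ` and expand. First order suffices: higher orders
are reached by induction, without the general Leibniz formula. -/
theorem HasWeakDeriv.smooth_mul (hfg : HasWeakDeriv Ω (Pi.single i 1) f g) (hΩ : IsOpen Ω)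
    (hη : ContDiff ℝ ∞ η) :
    HasWeakDeriv Ω (Pi.single i 1) (fun x => f x * η x)
      (fun x => g x * η x + f x * partialD i η x) := by
  have h1 : LocallyIntegrableOn (fun x => f x * η x) Ω :=
    hfg.1.mul_continuousOn hη.continuous.continuousOn hΩ.isLocallyClosed
  have h2 : LocallyIntegrableOn (fun x => g x * η x) Ω :=
    hfg.2.1.mul_continuousOn hη.continuous.continuousOn hΩ.isLocallyClosed
  have h3 : LocallyIntegrableOn (fun x => f x * partialD i η x) Ω :=
    hfg.1.mul_continuousOn (hη.partialD i).continuous.continuousOn hΩ.isLocallyClosed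
  refine ⟨h1, h2.add h3, fun φ hφ hφc hφs => ?_⟩
  have hφc' : HasCompactSupport (partialD i φ) :=
    hφc.of_isClosed_subset (isClosed_tsupport _) (tsupport_partialD_subset i)
  have key := hfg.2.2 (fun x => η x * φ x) (hη.mul hφ) hφc.mul_left
    ((closure_mono (Function.support_mul_subset_right η φ)).trans hφs)
  rw [multiD_single (hη.mul hφ)] at key
  simp only [partialD_mul hη hφ] at key
  rw [multiD_single hφ]
  simp only [Finset.sum_pi_single', Finset.mem_univ, if_true, pow_one, add_mul] at key ⊢
  have e1 : ∀ x, f x * (η x * partialD i φ x + partialD i η x * φ x) =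
      f x * η x * partialD i φ x + f x * partialD i η x * φ x := fun x => by ring
  have e2 : ∀ x, g x * η x * φ x = g x * (η x * φ x) := fun x => by ring
  simp_rw [e1] at key
  rw [integral_add (h1.integrableOn_mul (hφ.partialD i).continuous hφc'
      ((tsupport_partialD_subset i).trans hφs))
    (h3.integrableOn_mul hφ.continuous hφc hφs)] at key
  rw [integral_add (h2.integrableOn_mul hφ.continuous hφc hφs)
    (h3.integrableOn_mul hφ.continuous hφc hφs)]
  simp_rw [e2]
  rw [key]
  ring

end WeakDerivatives

/-! ### Sobolev functions, cutoffs and local approximation. -/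

section Sobolev

variable {n : ℕ} {Ω : Set (EuclideanSpace ℝ (Fin n))} {p : ℝ} {k : ℕ}
  {f f' η : EuclideanSpace ℝ (Fin n) → ℝ}

theorem MemSobolev.mono {l : ℕ} (hf : MemSobolev p k Ω f) (h : l ≤ k) : MemSobolev p l Ω f :=
  fun j hj => hf j (hj.trans h)

theorem MemSobolev.memLp (hΩ : IsOpen Ω) (hf : MemSobolev p k Ω f) :
    MemLp f (ENNReal.ofReal p) (volume.restrict Ω) := by
  obtain ⟨g, hg, hgp⟩ := hf 0 (by simp)
  exact hgp.ae_eq (hg.ae_eq hΩ (hasWeakDeriv_zero hg.1))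

theorem MemSobolev.locallyIntegrableOn (hf : MemSobolev p k Ω f) : LocallyIntegrableOn f Ω := by
  obtain ⟨g, hg, -⟩ := hf 0 (by simp)
  exact hg.1

theorem MemSobolev.exists_hasWeakDeriv_single (hf : MemSobolev p (k + 1) Ω f) (i : Fin n) :
    ∃ g, HasWeakDeriv Ω (Pi.single i 1) f g ∧ MemSobolev p k Ω g := by
  obtain ⟨g, hg, -⟩ := hf (Pi.single i 1) (by simp)
  refine ⟨g, hg, fun j hj => ?_⟩
  obtain ⟨h, hh, hhp⟩ := hf (j + Pi.single i 1) (by rw [sum_add_single]; omega)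
  exact ⟨h, hg.of_add_single hh, hhp⟩

theorem MemSobolev.sub (hf : MemSobolev p k Ω f) (hf' : MemSobolev p k Ω f') :
    MemSobolev p k Ω (f - f') := by
  intro j hj
  obtain ⟨g, hg, hgp⟩ := hf j hj
  obtain ⟨g', hg', hgp'⟩ := hf' j hj
  exact ⟨g - g', hg.sub hg', hgp.sub hgp'⟩

theorem MeasureTheory.MemLp.mul_of_hasCompactSupport {q : ENNReal} {μ : Measure (EuclideanSpace ℝ (Fin n))}
    (hf : MemLp f q μ) (hη : Continuous η) (hc : HasCompactSupport η) :
    MemLp (fun x => f x * η x) q μ := by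
  obtain ⟨C, hC⟩ := hη.bounded_above_of_compact_support hc
  refine hf.of_le_mul (c := C) (hf.aestronglyMeasurable.mul hη.aestronglyMeasurable)
    (.of_forall fun x => ?_)
  rw [norm_mul, mul_comm]
  gcongr
  exact hC x

/-- Induction on `j` through `∂_i (f η) = (∂_i f) η + f ∂_i η`, with `f`, `η` and `k` varying.
Vanishing at every point off `tsupport η` is carried along because the mollification argument needs
it away from the cone region. -/
theorem MemSobolev.exists_hasWeakDeriv_mul (hΩ : IsOpen Ω) (hf : MemSobolev p k Ω f)
    (hη : ContDiff ℝ ∞ η) (hc : HasCompactSupport η) {j : Fin n → ℕ} (hj : ∑ i, j i ≤ k) :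
    ∃ g, HasWeakDeriv Ω j (fun x => f x * η x) g ∧
      MemLp g (ENNReal.ofReal p) (volume.restrict Ω) ∧ ∀ x ∉ tsupport η, g x = 0 := by
  induction j using multiIndex_induction generalizing k f η with
  | zero =>
    refine ⟨_, hasWeakDeriv_zero ?_, MemLp.mul_of_hasCompactSupport (hf.memLp hΩ) hη.continuous hc,
      fun x hx => ?_⟩
    · exact hf.locallyIntegrableOn.mul_continuousOn hη.continuous.continuousOn hΩ.isLocallyClosed
    · simp [image_eq_zero_of_notMem_tsupport hx]
  | add_single j i ih =>
    rw [sum_add_single] at hj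
    obtain ⟨k, rfl⟩ : ∃ l, k = l + 1 := ⟨k - 1, by omega⟩
    obtain ⟨g, hg, hgk⟩ := hf.exists_hasWeakDeriv_single i
    have hc' : HasCompactSupport (partialD i η) :=
      hc.of_isClosed_subset (isClosed_tsupport _) (tsupport_partialD_subset i)
    obtain ⟨a, ha, hap, ha0⟩ := ih hgk hη hc (by omega)
    obtain ⟨b, hb, hbp, hb0⟩ := ih (hf.mono k.le_succ) (hη.partialD i) hc' (by omega)
    refine ⟨a + b, (hg.smooth_mul hΩ hη).trans (ha.add hb), hap.add hbp, fun x hx => ?_⟩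
    simp [ha0 x hx, hb0 x fun h => hx (tsupport_partialD_subset i h)]

theorem MemSobolev.mul_smooth (hΩ : IsOpen Ω) (hf : MemSobolev p k Ω f)
    (hη : ContDiff ℝ ∞ η) (hc : HasCompactSupport η) :
    MemSobolev p k Ω (fun x => f x * η x) := fun _ hj =>
  let ⟨g, hg, hgp, _⟩ := hf.exists_hasWeakDeriv_mul hΩ hη hc hj
  ⟨g, hg, hgp⟩

theorem ContDiff.memSobolev (hf : ContDiff ℝ ∞ f) (hb : Bornology.IsBounded Ω) (p : ℝ) (k : ℕ) :
    MemSobolev p k Ω f := by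
  intro j _
  refine ⟨_, hf.hasWeakDeriv Ω j, ?_⟩
  have hK : IsCompact (closure Ω) := hb.isCompact_closure
  have : IsFiniteMeasure (volume.restrict Ω) :=
    ⟨by simpa using (measure_mono subset_closure).trans_lt hK.measure_lt_top⟩
  obtain ⟨C, hC⟩ := hK.exists_bound_of_continuousOn (hf.multiD j).continuous.continuousOn
  refine MemLp.of_bound (hf.multiD j).continuous.aestronglyMeasurable C ?_
  have : ∀ᵐ x ∂volume.restrict (closure Ω), ‖_root_.multiD j f x‖ ≤ C :=
    ae_restrict_of_forall_mem isClosed_closure.measurableSet hC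
  exact ae_mono (Measure.restrict_mono subset_closure le_rfl) this

/-- `f` can be approximated in `W^{p,k}(Ω)` by restrictions of smooth functions on `ℝⁿ`. -/
def SmoothlyApproximable (p : ℝ) (k : ℕ) (Ω : Set (EuclideanSpace ℝ (Fin n)))
    (f : EuclideanSpace ℝ (Fin n) → ℝ) : Prop :=
  ∀ ε : ENNReal, ε ≠ 0 → ∃ ψ : EuclideanSpace ℝ (Fin n) → ℝ, ContDiff ℝ ∞ ψ ∧
    ∀ j : Fin n → ℕ, ∑ i, j i ≤ k → ∃ h, HasWeakDeriv Ω j (f - ψ) h ∧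
      eLpNorm h (ENNReal.ofReal p) (volume.restrict Ω) ≤ ε

theorem SmoothlyApproximable.add (hp : 1 ≤ p) (hf : SmoothlyApproximable p k Ω f)
    (hf' : SmoothlyApproximable p k Ω f') : SmoothlyApproximable p k Ω (f + f') := by
  intro ε hε
  obtain ⟨ψ, hψ, H⟩ := hf (ε / 2) (ENNReal.half_pos hε).ne'
  obtain ⟨ψ', hψ', H'⟩ := hf' (ε / 2) (ENNReal.half_pos hε).ne'
  refine ⟨ψ + ψ', hψ.add hψ', fun j hj => ?_⟩
  obtain ⟨h, hw, hn⟩ := H j hj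
  obtain ⟨h', hw', hn'⟩ := H' j hj
  refine ⟨h + h', add_sub_add_comm f f' ψ ψ' ▸ hw.add hw', ?_⟩
  calc _ ≤ _ := eLpNorm_add_le hw.2.1.aestronglyMeasurable hw'.2.1.aestronglyMeasurable
        (by simpa using hp)
    _ ≤ ε / 2 + ε / 2 := add_le_add hn hn'
    _ = ε := ENNReal.add_halves ε

theorem smoothlyApproximable_of_eqOn_zero (hΩ : IsOpen Ω) (hf : Set.EqOn f 0 Ω) :
    SmoothlyApproximable p k Ω f := by
  refine fun ε _ => ⟨0, contDiff_const, fun j _ => ⟨0, ?_, by simp⟩⟩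
  have h0 : HasWeakDeriv Ω j 0 0 :=
    ⟨locallyIntegrable_zero.locallyIntegrableOn _, locallyIntegrable_zero.locallyIntegrableOn _,
      by simp⟩
  exact h0.congr_left hΩ fun x hx => by simp [hf hx]

/-- Near `x₀`, every point of `Ω` is the vertex of a truncated cone in `Ω`, the same one up to
translation. -/
def HasInteriorCone (Ω : Set (EuclideanSpace ℝ (Fin n))) (x₀ : EuclideanSpace ℝ (Fin n))
    (r : ℝ) : Prop :=
  ∃ (v : EuclideanSpace ℝ (Fin n)) (c τ : ℝ), 0 < c ∧ 0 < τ ∧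
    ∀ x ∈ Ω, dist x x₀ < r → ∀ t, 0 < t → t < τ → ∀ w, ‖w - v‖ ≤ c → x + t • w ∈ Ω

theorem HasInteriorCone.smoothlyApproximable_mul {x₀ : EuclideanSpace ℝ (Fin n)} {r : ℝ}
    (hΩ : IsOpen Ω) (hr : 0 < r) (hcone : HasInteriorCone Ω x₀ r) (hp : 1 ≤ p)
    (hf : MemSobolev p k Ω f) (hη : ContDiff ℝ ∞ η)
    (hηs : tsupport η ⊆ Metric.closedBall x₀ (r / 2)) :
    SmoothlyApproximable p k Ω (fun x => f x * η x) := by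
  intro ε hε
  have hηc : HasCompactSupport η :=
    (isCompact_closedBall _ _).of_isClosed_subset (isClosed_tsupport _) hηs
  obtain ⟨v, c, τ, hc, hτ, hcone⟩ := hcone
  have hq : 1 ≤ ENNReal.ofReal p := by simpa using hp
  have hderiv : ∀ j : Fin n → ℕ, ∑ i, j i ≤ k → ∃ g, HasWeakDeriv Ω j (fun x => f x * η x) g ∧
      MemLp g (ENNReal.ofReal p) (volume.restrict Ω) ∧ ∀ x ∉ tsupport η, g x = 0 :=
    fun j hj => hf.exists_hasWeakDeriv_mul hΩ hη hηc hj
  choose! g hg hgp hg0 using hderiv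
  have hgL : ∀ j, ∑ i, j i ≤ k → MemLp (Ω.indicator (g j)) (ENNReal.ofReal p) volume :=
    fun j hj => (memLp_indicator_iff_restrict hΩ.measurableSet).2 (hgp j hj)
  set u : EuclideanSpace ℝ (Fin n) → ℝ := Ω.indicator fun x => f x * η x with hu
  have huL : MemLp u (ENNReal.ofReal p) volume :=
    (memLp_indicator_iff_restrict hΩ.measurableSet).2 ((hf.mul_smooth hΩ hη hηc).memLp hΩ)
  have huloc : LocallyIntegrable u := huL.locallyIntegrable hq
  obtain ⟨δ, hδ, hδε⟩ : ∃ δ > 0, ∀ y : EuclideanSpace ℝ (Fin n), ‖y‖ < δ →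
      ∀ j ∈ multiIndices n k, eLpNorm (fun x => Ω.indicator (g j) (x - y) - Ω.indicator (g j) x)
        (ENNReal.ofReal p) volume ≤ ε := by
    have := (Filter.eventually_all_finset (multiIndices n k)).2 fun j hj =>
      eventually_eLpNorm_comp_sub_sub_le hq ENNReal.ofReal_ne_top
        (hgL j (mem_multiIndices.1 hj)) hε
    simpa using Metric.eventually_nhds_iff.1 this
  -- `t * (‖v‖ + c)` bounds the norm on the mollifier's support: below `δ` for the `L^p` estimate,
  -- below `r / 2` so that points at distance at least `r` from `x₀` never sample the support of
  -- `η`.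
  obtain ⟨t, ht0, htτ, htδ, htr⟩ :
      ∃ t, 0 < t ∧ t < τ ∧ t * (‖v‖ + c) < δ ∧ t * (‖v‖ + c) < r / 2 := by
    have hlim : Filter.Tendsto (fun t : ℝ => t * (‖v‖ + c)) (nhdsWithin 0 (Set.Ioi 0))
        (nhds 0) := by
      have : Continuous fun t : ℝ => t * (‖v‖ + c) := by fun_prop
      simpa using (this.tendsto 0).mono_left nhdsWithin_le_nhds
    have hIoo : ∀ᶠ t : ℝ in nhdsWithin 0 (Set.Ioi 0), t ∈ Set.Ioo 0 τ := Ioo_mem_nhdsGT hτ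
    obtain ⟨t, ht, h1, h2⟩ := (hIoo.and ((hlim.eventually_lt_const hδ).and
      (hlim.eventually_lt_const (half_pos hr)))).exists
    exact ⟨t, ht.1, ht.2, h1, h2⟩
  -- Convolution evaluates `u (x - y)`, so centring at `-(t • v)` samples near `x + t • v`, inside
  -- the cone.
  let b : ContDiffBump (-(t • v)) :=
    ⟨t * c / 2, t * c, half_pos (mul_pos ht0 hc), half_lt_self (mul_pos ht0 hc)⟩
  set ρ : EuclideanSpace ℝ (Fin n) → ℝ := b.normed volume with hρ
  have hρs : ContDiff ℝ ∞ ρ := b.contDiff_normed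
  have hρc : HasCompactSupport ρ := b.hasCompactSupport_normed
  have hρt : ∀ y ∈ tsupport ρ, ‖y + t • v‖ ≤ t * c := by
    intro y hy
    rw [hρ, b.tsupport_normed_eq, Metric.mem_closedBall, dist_eq_norm, sub_neg_eq_add] at hy
    exact hy
  have hρn : ∀ y ∈ tsupport ρ, ‖y‖ ≤ t * (‖v‖ + c) := by
    intro y hy
    calc ‖y‖ = ‖(y + t • v) - t • v‖ := by rw [add_sub_cancel_right]
      _ ≤ ‖y + t • v‖ + ‖t • v‖ := norm_sub_le _ _
      _ ≤ t * c + t * ‖v‖ := by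
        rw [norm_smul, Real.norm_of_nonneg ht0.le]; gcongr; exact hρt y hy
      _ = _ := by ring
  have hfar : ∀ x z, r ≤ dist x x₀ → x - z ∈ tsupport ρ → z ∉ tsupport η := by
    intro x z hx hz hzη
    have h1 := hρn _ hz
    have h2 := hηs hzη
    rw [Metric.mem_closedBall] at h2
    have h3 := dist_triangle x z x₀
    rw [dist_eq_norm x z] at h3
    linarith
  -- The heart of the argument. For `x` near `x₀` the cone makes `z ↦ ρ (x - z)` a test function on
  -- Ω, and the signs from reflection and from the weak derivative cancel. For `x` far away both
  -- sides vanish.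
  have hconv : ∀ j, ∑ i, j i ≤ k → ∀ x ∈ Ω,
      multiD j (convolution u ρ (ContinuousLinearMap.mul ℝ ℝ) volume) x =
        convolution (Ω.indicator (g j)) ρ (ContinuousLinearMap.mul ℝ ℝ) volume x := by
    intro j hj x hx
    rw [multiD_convolution huloc hρs hρc]
    simp only [convolution, ContinuousLinearMap.mul_apply']
    rcases lt_or_ge (dist x x₀) r with hxr | hxr
    · have hs : tsupport (fun z => ρ (x - z)) ⊆ Ω := by
        intro z hz
        have hz' : x - z ∈ tsupport ρ :=
          tsupport_comp_subset_preimage ρ (continuous_const.sub continuous_id) hz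
        have hw := hcone x hx hxr t ht0 htτ (t⁻¹ • (z - x)) ?_
        · rwa [smul_inv_smul₀ ht0.ne', add_sub_cancel] at hw
        · have h1 : t⁻¹ • (z - x) - v = -(t⁻¹ • (x - z + t • v)) := by
            rw [smul_add, inv_smul_smul₀ ht0.ne', ← neg_sub x z, smul_neg]; abel
          rw [h1, norm_neg, norm_smul, norm_inv, Real.norm_of_nonneg ht0.le,
            inv_mul_le_iff₀ ht0]
          exact hρt _ hz'
      have key := (hg j hj).2.2 (fun z => ρ (x - z)) (hρs.comp (contDiff_const.sub contDiff_id))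
        (hρc.comp_homeomorph (Homeomorph.subLeft x)) hs
      rw [multiD_comp_sub_left hρs] at key
      have e : ∀ (F G : EuclideanSpace ℝ (Fin n) → ℝ),
          ∫ z, Ω.indicator F z * G z = ∫ z in Ω, F z * G z := by
        intro F G
        rw [← integral_indicator hΩ.measurableSet]
        exact integral_congr_ae (.of_forall fun z => (Set.indicator_mul_left Ω F G).symm)
      rw [hu, e, e _ fun z => ρ (x - z), key]
      have e2 : ∀ z, f z * η z * ((-1) ^ (∑ i, j i) * multiD j ρ (x - z)) =
          (-1) ^ (∑ i, j i) * (f z * η z * multiD j ρ (x - z)) := fun z => by ring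
      simp_rw [e2]
      rw [integral_const_mul, ← mul_assoc, ← pow_add, Even.neg_one_pow ⟨_, rfl⟩, one_mul]
    · refine integral_congr_ae (.of_forall fun z => ?_)
      by_cases hz : x - z ∈ tsupport ρ
      · have h0 := hfar x z hxr hz
        by_cases hzΩ : z ∈ Ω <;>
          simp [hu, hzΩ, image_eq_zero_of_notMem_tsupport h0, hg0 j hj z h0]
      · simp [image_eq_zero_of_notMem_tsupport hz, image_eq_zero_of_notMem_tsupport
          fun h => hz (tsupport_multiD_subset hρs j h)]
  have hψ : ContDiff ℝ ∞ (convolution u ρ (ContinuousLinearMap.mul ℝ ℝ) volume) :=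
    hρc.contDiff_convolution_right _ huloc hρs
  refine ⟨_, hψ, fun j hj => ⟨_, (hg j hj).sub (hψ.hasWeakDeriv Ω j), ?_⟩⟩
  calc _ = eLpNorm (fun x => Ω.indicator (g j) x -
          convolution (Ω.indicator (g j)) ρ (ContinuousLinearMap.mul ℝ ℝ) volume x)
          (ENNReal.ofReal p) (volume.restrict Ω) := by
        refine eLpNorm_congr_ae (ae_restrict_of_forall_mem hΩ.measurableSet fun x hx => ?_)
        simp only [Pi.sub_apply, hconv j hj x hx, Set.indicator_of_mem hx]
    _ ≤ _ := eLpNorm_mono_measure _ Measure.restrict_le_self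
    _ ≤ ε := by
        refine eLpNorm_convolution_sub_le hq ENNReal.ofReal_ne_top (hgL j hj) hρs.continuous hρc
          b.nonneg_normed b.integral_normed fun y hy => ?_
        exact hδε y ((hρn y (subset_tsupport _ hy)).trans_lt htδ) j (mem_multiIndices.2 hj)

/-- Peel off one ball at a time: `f = f b + f (1 - b)`. The first term is supported where the cone
at `a` applies; the second vanishes on Ω within `r a / 4` of `a`, so the remaining balls suffice.
This replaces a partition of unity. -/
theorem MemSobolev.smoothlyApproximable_of_cover {r : EuclideanSpace ℝ (Fin n) → ℝ}
    (hΩ : IsOpen Ω) (hp : 1 ≤ p) (s : Finset (EuclideanSpace ℝ (Fin n)))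
    (hr : ∀ a ∈ s, 0 < r a) (hcone : ∀ a ∈ s, HasInteriorCone Ω a (r a))
    (hf : MemSobolev p k Ω f) (h0 : ∀ x ∈ Ω, (∀ a ∈ s, r a / 4 < dist x a) → f x = 0) :
    SmoothlyApproximable p k Ω f := by
  classical
  induction s using Finset.induction_on generalizing f with
  | empty => exact smoothlyApproximable_of_eqOn_zero hΩ fun x hx => h0 x hx (by simp)
  | insert a s _ ih =>
    have ha := hr a (Finset.mem_insert_self a s)
    let b : ContDiffBump a := ⟨r a / 4, r a / 2, by positivity, by linarith⟩
    have hb : ContDiff ℝ ∞ b := b.contDiff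
    have h1 : SmoothlyApproximable p k Ω (fun x => f x * b x) :=
      (hcone a (Finset.mem_insert_self a s)).smoothlyApproximable_mul hΩ ha hp hf hb
        b.tsupport_eq.subset
    have h2 : SmoothlyApproximable p k Ω (f - fun x => f x * b x) := by
      refine ih (fun x hx => hr x (Finset.mem_insert_of_mem hx))
        (fun x hx => hcone x (Finset.mem_insert_of_mem hx))
        (hf.sub (hf.mul_smooth hΩ hb b.hasCompactSupport)) fun x hx hxs => ?_
      rcases le_or_gt (dist x a) (r a / 4) with hxa | hxa
      · simp [b.one_of_mem_closedBall hxa]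
      · have : f x = 0 := h0 x hx fun c hc => by
          rcases Finset.mem_insert.1 hc with rfl | hc
          · exact hxa
          · exact hxs c hc
        simp [this]
    have := h1.add hp h2
    rwa [add_sub_cancel] at this

end Sobolev

/-! ### The cone property of `C¹` domains and global real approximation. -/

section Domain

variable {n : ℕ} {Ω : Set (EuclideanSpace ℝ (Fin n))} {p : ℝ} {k : ℕ}

theorem IsOpen.exists_hasInteriorCone (hΩ : IsOpen Ω) {x₀ : EuclideanSpace ℝ (Fin n)}
    (hx₀ : x₀ ∈ Ω) : ∃ r, 0 < r ∧ HasInteriorCone Ω x₀ r := by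
  obtain ⟨r, hr, hball⟩ := Metric.isOpen_iff.1 hΩ x₀ hx₀
  -- With axis `0` and aperture `1` the cone is a ball around `x`; half the radius is spent on `x`,
  -- half on the displacement.
  refine ⟨r / 2, half_pos hr, 0, 1, r / 2, one_pos, half_pos hr, fun x _ hx t ht ht' w hw => ?_⟩
  refine hball ?_
  rw [sub_zero] at hw
  rw [Metric.mem_ball]
  calc dist (x + t • w) x₀ ≤ dist (x + t • w) x + dist x x₀ := dist_triangle _ _ _
    _ = t * ‖w‖ + dist x x₀ := by
      rw [dist_eq_norm, add_sub_cancel_left, norm_smul, Real.norm_of_nonneg ht.le]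
    _ < r := by nlinarith

/-- Let `L` be a local Lipschitz constant of `γ`. A displacement `t • w` with `‖w - v‖ ≤ c` raises
the height by at least `t (1 - c)` and `γ` by at most `t L c`. The choice `c = 1 / (1 + L)` makes
these equal, so the strict inequality at `x` persists. -/
theorem HasC1Boundary.exists_hasInteriorCone (hΩ : HasC1Boundary Ω)
    {x₀ : EuclideanSpace ℝ (Fin n)} (hx₀ : x₀ ∈ frontier Ω) :
    ∃ r, 0 < r ∧ HasInteriorCone Ω x₀ r := by
  obtain ⟨R, v, γ, hR, hv, hγ, hiff⟩ := hΩ x₀ hx₀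
  set P := (Submodule.span ℝ {v})ᗮ.orthogonalProjectionOnto with hP
  obtain ⟨L, s, hs, hL⟩ := (hγ.contDiffAt (x := P x₀)).exists_lipschitzOnWith
  obtain ⟨d, hd, hds⟩ := Metric.mem_nhds_iff.1 hs
  have hPle : ∀ y, ‖P y‖ ≤ ‖y‖ := fun y => Submodule.norm_orthogonalProjectionOnto_apply_le _ y
  have hPv : P v = 0 := by
    rw [hP, Submodule.orthogonalProjectionOnto_eq_zero_iff]
    exact Submodule.le_orthogonal_orthogonal _ (Submodule.mem_span_singleton_self v)
  -- Since `‖w‖ ≤ 2` and `t < m / 2`, the displaced point stays within `2 * m` of `x₀`, where both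
  -- the graph description and the Lipschitz bound hold.
  set m := min R d / 2 with hm
  have hm0 : 0 < m := by positivity
  have hmR : 2 * m ≤ R := by rw [hm]; linarith [min_le_left R d]
  have hmd : 2 * m ≤ d := by rw [hm]; linarith [min_le_right R d]
  have hL1 : 0 < 1 + (L : ℝ) := by positivity
  have hLc : (1 + (L : ℝ)) * (1 + (L : ℝ))⁻¹ = 1 := mul_inv_cancel₀ hL1.ne'
  have hc0 : 0 < (1 + (L : ℝ))⁻¹ := inv_pos.2 hL1
  have hc1 : (1 + (L : ℝ))⁻¹ ≤ 1 := inv_le_one_of_one_le₀ (by simp)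
  refine ⟨m, hm0, v, (1 + (L : ℝ))⁻¹, m / 2, hc0, half_pos hm0,
    fun x hx hxr t ht0 htm w hw => ?_⟩
  have hw2 : ‖w‖ ≤ 2 := by
    calc ‖w‖ = ‖(w - v) + v‖ := by rw [sub_add_cancel]
      _ ≤ ‖w - v‖ + ‖v‖ := norm_add_le _ _
      _ ≤ 2 := by linarith
  have hx' : dist (x + t • w) x₀ < 2 * m := by
    calc dist (x + t • w) x₀ ≤ dist (x + t • w) x + dist x x₀ := dist_triangle _ _ _
      _ = t * ‖w‖ + dist x x₀ := by
        rw [dist_eq_norm, add_sub_cancel_left, norm_smul, Real.norm_of_nonneg ht0.le]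
      _ < 2 * m := by nlinarith
  have hPs : ∀ y, dist y x₀ < 2 * m → P y ∈ s := by
    intro y hy
    refine hds ?_
    rw [Metric.mem_ball, dist_eq_norm, ← map_sub]
    rw [dist_eq_norm] at hy
    exact (hPle _).trans_lt (hy.trans_le hmd)
  have hγx := (hiff x (Metric.mem_ball.2 (by linarith))).1 hx
  refine (hiff _ (Metric.mem_ball.2 (hx'.trans_le hmR))).2 ?_
  have hPw : ‖P w‖ ≤ (1 + (L : ℝ))⁻¹ := by
    calc ‖P w‖ = ‖P (w - v)‖ := by rw [map_sub, hPv, sub_zero]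
      _ ≤ _ := (hPle _).trans hw
  have hlip : γ (P (x + t • w)) - γ (P x) ≤ L * (t * ‖P w‖) := by
    have h := hL.dist_le_mul _ (hPs _ hx') _ (hPs x (by linarith))
    rw [dist_eq_norm (P (x + t • w)), map_add, add_sub_cancel_left, map_smul, norm_smul,
      Real.norm_of_nonneg ht0.le, Real.dist_eq] at h
    rw [map_add, map_smul]
    exact (le_abs_self _).trans h
  have hinner : 1 - (1 + (L : ℝ))⁻¹ ≤ inner ℝ v w := by
    have h1 : inner ℝ v w = 1 + inner ℝ v (w - v) := by
      rw [inner_sub_right, real_inner_self_eq_norm_sq, hv]; ring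
    have h2 := abs_le.1 (abs_real_inner_le_norm v (w - v))
    rw [hv, one_mul] at h2
    linarith [h2.1]
  have hbound : (L : ℝ) * (t * ‖P w‖) ≤ t * inner ℝ v w := by
    have : (L : ℝ) * ‖P w‖ ≤ inner ℝ v w := by
      have := mul_le_mul_of_nonneg_left hPw L.coe_nonneg
      linarith
    nlinarith
  rw [inner_add_right, inner_smul_right]
  linarith

theorem IsBoundedC1Domain.exists_hasInteriorCone (hΩ : IsBoundedC1Domain Ω)
    {x₀ : EuclideanSpace ℝ (Fin n)} (hx₀ : x₀ ∈ closure Ω) :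
    ∃ r, 0 < r ∧ HasInteriorCone Ω x₀ r := by
  by_cases h : x₀ ∈ Ω
  · exact hΩ.isOpen.exists_hasInteriorCone h
  · exact hΩ.hasC1Boundary.exists_hasInteriorCone
      (hΩ.isOpen.frontier_eq ▸ ⟨hx₀, h⟩)

theorem MemSobolev.smoothlyApproximable (hΩ : IsBoundedC1Domain Ω) (hp : 1 ≤ p)
    {f : EuclideanSpace ℝ (Fin n) → ℝ} (hf : MemSobolev p k Ω f) :
    SmoothlyApproximable p k Ω f := by
  have hex : ∀ x ∈ closure Ω, ∃ r, 0 < r ∧ HasInteriorCone Ω x r :=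
    fun x hx => hΩ.exists_hasInteriorCone hx
  choose! r hr hcone using hex
  obtain ⟨s, hs, hcover⟩ := hΩ.isBounded.isCompact_closure.elim_nhds_subcover
    (fun a => Metric.closedBall a (r a / 4))
    fun a ha => Metric.closedBall_mem_nhds a (by linarith [hr a ha])
  refine hf.smoothlyApproximable_of_cover hΩ.isOpen hp s (fun a ha => hr a (hs a ha))
    (fun a ha => hcone a (hs a ha)) fun x hx hfar => ?_
  obtain ⟨a, ha, hxa⟩ := Set.mem_iUnion₂.1 (hcover (subset_closure hx))
  exact absurd hxa (not_le.2 (hfar a ha))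

/-! ### From real sections to `Cl n`-valued functions. -/

theorem HasWeakDeriv.eLpNorm_weakD (hΩ : IsOpen Ω) {j : Fin n → ℕ}
    {f g : EuclideanSpace ℝ (Fin n) → ℝ} (hg : HasWeakDeriv Ω j f g) (q : ENNReal) :
    eLpNorm (weakD Ω j f) q (volume.restrict Ω) = eLpNorm g q (volume.restrict Ω) := by
  have h : ∃ g, HasWeakDeriv Ω j f g := ⟨g, hg⟩
  rw [weakD, dif_pos h]
  exact eLpNorm_congr_ae (h.choose_spec.ae_eq hΩ hg)

theorem cliffordSection_sum {X : Type*} (ψ : Finset (Fin n) → X → ℝ) (A : Finset (Fin n)) :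
    cliffordSection (fun x => ∑ B, ψ B x • cliffordMonomial B) A = ψ A := by
  funext x
  simp only [cliffordSection, ← cliffordBasis_apply]
  rw [Module.Basis.repr_sum_self]

theorem cliffordSection_sub {X : Type*} (f g : X → Cl n) (A : Finset (Fin n)) :
    cliffordSection (f - g) A = cliffordSection f A - cliffordSection g A := by
  funext x
  simp [cliffordSection]

end Domain

theorem mainTheorem1 {n : ℕ} {Ω : Set (EuclideanSpace ℝ (Fin n))} (hΩ : IsBoundedC1Domain Ω)
    {p : ℝ} (hp : 1 < p) (k : ℕ) (f : EuclideanSpace ℝ (Fin n) → Cl n)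
    (hf : MemCliffordSobolev p k Ω f) (ε : ℝ) (hε : 0 < ε) :
    ∃ Ψ : EuclideanSpace ℝ (Fin n) → Cl n,
      (∀ A, SmoothUpToBoundary Ω (cliffordSection Ψ A)) ∧
      MemCliffordSobolev p k Ω Ψ ∧
      cliffordSobolevNorm p k Ω (f - Ψ) < ENNReal.ofReal ε := by
  have hp0 : 0 < p := zero_lt_one.trans hp
  -- Each pair of a section and a multi-index will contribute at most `δ ^ p`; the resulting bound
  -- is continuous in `δ` and vanishes at `0`.
  obtain ⟨δ, hδ, hδε⟩ : ∃ δ : ENNReal, δ ≠ 0 ∧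
      (Fintype.card (Finset (Fin n)) * ((multiIndices n k).card * δ ^ p)) ^ p⁻¹ <
        ENNReal.ofReal ε := by
    have hc : Continuous fun δ : ENNReal =>
        ((Fintype.card (Finset (Fin n)) : ENNReal) * ((multiIndices n k).card * δ ^ p)) ^ p⁻¹ :=
      ENNReal.continuous_rpow_const.comp <|
        (ENNReal.continuous_const_mul (ENNReal.natCast_ne_top _)).comp <|
          (ENNReal.continuous_const_mul (ENNReal.natCast_ne_top _)).comp
            ENNReal.continuous_rpow_const
    have h0 := (hc.tendsto 0).eventually_lt_const (u := ENNReal.ofReal ε) (by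
      simp [ENNReal.zero_rpow_of_pos, hp0, hε])
    obtain ⟨δ, hδ, hδ0⟩ := ((h0.filter_mono nhdsWithin_le_nhds).and
      (self_mem_nhdsWithin (s := Set.Ioi (0 : ENNReal)))).exists
    exact ⟨δ, (Set.mem_Ioi.1 hδ0).ne', hδ⟩
  choose ψ hψ happ using fun A => (hf A).smoothlyApproximable hΩ hp.le δ hδ
  refine ⟨fun x => ∑ B, ψ B x • cliffordMonomial B, fun A => ?_, fun A => ?_, ?_⟩
  · rw [cliffordSection_sum]
    exact ⟨ψ A, hψ A, fun _ _ => rfl⟩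
  · rw [cliffordSection_sum]
    exact (hψ A).memSobolev hΩ.isBounded p k
  · refine lt_of_le_of_lt ?_ hδε
    rw [cliffordSobolevNorm]
    gcongr
    rw [← nsmul_eq_mul, ← Finset.card_univ]
    refine Finset.sum_le_card_nsmul _ _ _ fun A _ => ?_
    rw [sobolevNorm, ← ENNReal.rpow_mul, inv_mul_cancel₀ hp0.ne', ENNReal.rpow_one,
      ← nsmul_eq_mul]
    refine Finset.sum_le_card_nsmul _ _ _ fun j hj => ?_
    obtain ⟨h, hw, hle⟩ := happ A j (mem_multiIndices.1 hj)
    rw [cliffordSection_sub, cliffordSection_sum, hw.eLpNorm_weakD hΩ.isOpen]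
    gcongr
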